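/- Let $K$ be a field with an involution $\bar{\ }$, i.e. an additive map with $\overline{ab}=\bar b\,\bar a$ and $\overline{\bar a}=a$. Let $E=(E^0,E^1,r,s)$ be an arbitrary directed graph: $E^0$ (vertices) and $E^1$ (edges) are sets of any cardinality and $r,s:E^1\to E^0$ are any maps. The Leavitt path algebra $L_K(E)$ is the associative, not necessarily unital, $K$-algebra generated by $E^0\cup E^1\cup\{e^*: e\in E^1\}$ subject to the relations - $vw=\delta_{v,w}v$ for all $v,w\in E^0$; - $s(e)e=e\,r(e)=e$ and $r(e)e^*=e^*s(e)=e^*$ for all $e\in E^1$; - $e^*f=\delta_{e,f}\,r(e)$ for all $e,f\in E^1$; - $v=\sum_{e\in s^{-1}(v)}ee^*$ for every $v\in E^0$ for which $s^{-1}(v)$ is finite and nonempty. The involution of $K$ induces an involution $^*$ on $L_K(E)$, namely the additive map with $(xy)^*=y^*x^*$, $(kx)^*=\bar k x^*$ for $k\in K$, $v^*=v$ for $v\in E^0$, and $(e)^*=e^*$, $(e^*)^*=e$ for $e\in E^1$; thus $\bigl(\sum_i k_ip_iq_i^*\bigr)^*=\sum_i\overline{k_i}\,q_ip_i^*$ for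 paths $p_i,q_i$. An involution $^*$ on a ring $R$ is called $n$-proper if $x_1^*x_1+\dots+x_n^*x_n=0$ implies $x_1=\dots=x_n=0$ for all $x_1,\dots,x_n\in R$; it is called proper if it is $1$-proper, and positive definite if it is $n$-proper for every positive integer $n$. **Proposition.** If the involution on $K$ is positive definite, then the induced involution on $L_K(E)$ is proper. -/

import Mathlib

/-- A directed graph `(E⁰, E¹, r, s)`: a set of vertices, a set of edges (both of arbitrary
cardinality; loops and parallel edges are allowed), and the source and range maps. -/
structure DirectedGraph (V : Type*) (W : Type*) where
  /-- the source of an edge -/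
  s : W → V
  /-- the range of an edge -/
  r : W → V

section ProperInvolutions

/-- The involution of a `*`-ring `R` (not necessarily unital) is `n`-proper if
`x₁* x₁ + ⋯ + xₙ* xₙ = 0` implies `x₁ = ⋯ = xₙ = 0`. -/
def IsNProper (n : ℕ) (R : Type*) [NonUnitalRing R] [StarRing R] : Prop :=
  ∀ x : Fin n → R, ∑ i, star (x i) * x i = 0 → ∀ i, x i = 0

/-- The involution of `R` is proper if it is `1`-proper. -/
def IsProperInvolution (R : Type*) [NonUnitalRing R] [StarRing R] : Prop :=
  IsNProper 1 R

/-- The involution of `R` is positive definite if it is `n`-proper for every positive `n`. -/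
def IsPositiveDefiniteInvolution (R : Type*) [NonUnitalRing R] [StarRing R] : Prop :=
  ∀ n : ℕ, 0 < n → IsNProper n R

theorem isProperInvolution_iff (R : Type*) [NonUnitalRing R] [StarRing R] :
    IsProperInvolution R ↔ ∀ a : R, star a * a = 0 → a = 0 := by
  constructor
  · intro h a ha
    exact h (fun _ => a) (by simpa using ha) 0
  · intro h x hx i
    rw [Fin.sum_univ_one] at hx
    rw [Subsingleton.elim i 0]
    exact h _ hx

end ProperInvolutions

namespace Leavitt

/-- The generators of the Leavitt path algebra: the vertices, the edges `e`, and the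
ghost edges `e*`. -/
inductive Gen (V : Type*) (W : Type*) where
  | vertex (v : V) : Gen V W
  | edge (e : W) : Gen V W
  | ghost (e : W) : Gen V W

namespace Gen

/-- The involution on generators: it fixes vertices and exchanges `e` and `e*`. -/
def adj {V W : Type*} : Gen V W → Gen V W
  | vertex v => vertex v
  | edge e => ghost e
  | ghost e => edge e

theorem adj_adj {V W : Type*} (g : Gen V W) : g.adj.adj = g := by
  cases g <;> rfl

end Gen

/-- The free associative (non-unital) `K`-algebra on the generators, realised as the
semigroup algebra of the free semigroup of nonempty words. -/
abbrev Free (K : Type*) [Field K] (V : Type*) (W : Type*) :=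
  MonoidAlgebra K (FreeSemigroup (Gen V W))

section FreeStar

/-- Reversal of words, with every letter replaced by its adjoint. -/
def revWord {V W : Type*} (w : FreeSemigroup (Gen V W)) : FreeSemigroup (Gen V W) :=
  MulOpposite.unop
    (FreeSemigroup.lift (fun g : Gen V W => MulOpposite.op (FreeSemigroup.of g.adj)) w)

theorem revWord_of {V W : Type*} (g : Gen V W) :
    revWord (FreeSemigroup.of g) = FreeSemigroup.of g.adj := by
  simp [revWord]

theorem revWord_mul {V W : Type*} (x y : FreeSemigroup (Gen V W)) :
    revWord (x * y) = revWord y * revWord x := by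
  simp [revWord]

theorem revWord_revWord {V W : Type*} (x : FreeSemigroup (Gen V W)) :
    revWord (revWord x) = x := by
  induction x using FreeSemigroup.recOnMul with
  | ih1 g => rw [revWord_of, revWord_of, Gen.adj_adj]
  | ih2 g y h₁ h₂ => rw [revWord_mul, revWord_mul, h₁, h₂]

variable {K : Type*} [Field K] [StarRing K] {V W : Type*}

/-- The conjugate-linear extension of `revWord` to the free algebra:
`∑ kᵢ wᵢ ↦ ∑ k̄ᵢ wᵢ*`. -/
noncomputable def freeStar : Free K V W →+ Free K V W :=
  (Finsupp.liftAddHom fun w : FreeSemigroup (Gen V W) =>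
    (MonoidAlgebra.singleAddHom (revWord w)).comp (starAddEquiv (R := K)).toAddMonoidHom).comp
    (MonoidAlgebra.coeffAddEquiv (R := K)).toAddMonoidHom

theorem freeStar_single (w : FreeSemigroup (Gen V W)) (k : K) :
    freeStar (MonoidAlgebra.single w k) = MonoidAlgebra.single (revWord w) (star k) := by
  simp [freeStar]

theorem freeStar_freeStar (x : Free K V W) : freeStar (freeStar x) = x := by
  have h : (freeStar (K := K) (V := V) (W := W)).comp freeStar = AddMonoidHom.id _ := by
    apply MonoidAlgebra.addMonoidHom_ext
    intro w k
    simp [freeStar_single, revWord_revWord]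
  exact DFunLike.congr_fun h x

theorem freeStar_mul (x y : Free K V W) : freeStar (x * y) = freeStar y * freeStar x := by
  induction x using MonoidAlgebra.induction_linear with
  | zero => simp
  | add f g hf hg => rw [add_mul, map_add, map_add, mul_add, hf, hg]
  | single w k =>
    induction y using MonoidAlgebra.induction_linear with
    | zero => simp
    | add f g hf hg => rw [mul_add, map_add, map_add, add_mul, hf, hg]
    | single w' k' =>
      simp [freeStar_single, MonoidAlgebra.single_mul_single, revWord_mul, mul_comm]

theorem freeStar_smul (k : K) (x : Free K V W) : freeStar (k • x) = star k • freeStar x := by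
  induction x using MonoidAlgebra.induction_linear with
  | zero => simp
  | add f g hf hg => rw [smul_add, map_add, map_add, smul_add, hf, hg]
  | single w k' => simp [freeStar_single]

end FreeStar

section Relations

variable {K : Type*} [Field K] {V W : Type*}

/-- A generator, as an element of the free algebra. -/
noncomputable def gen (g : Gen V W) : Free K V W :=
  MonoidAlgebra.single (FreeSemigroup.of g) 1

theorem freeStar_gen [StarRing K] (g : Gen V W) :
    freeStar (gen g : Free K V W) = gen g.adj := by
  simp [gen, freeStar_single, revWord_of]

open Gen in
/-- The defining relations (V), (P1), (P2), (CK1), (CK2) of the Leavitt path algebra; (CK2) is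
imposed exactly at the vertices which emit a finite nonzero number of edges. -/
inductive Rel (E : DirectedGraph V W) : Free K V W → Free K V W → Prop
  | vertex_mul_self (v : V) : Rel E (gen (vertex v) * gen (vertex v)) (gen (vertex v))
  | vertex_mul_of_ne (v w : V) (h : v ≠ w) : Rel E (gen (vertex v) * gen (vertex w)) 0
  | source_mul_edge (e : W) : Rel E (gen (vertex (E.s e)) * gen (edge e)) (gen (edge e))
  | edge_mul_range (e : W) : Rel E (gen (edge e) * gen (vertex (E.r e))) (gen (edge e))
  | range_mul_ghost (e : W) : Rel E (gen (vertex (E.r e)) * gen (ghost e)) (gen (ghost e))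
  | ghost_mul_source (e : W) : Rel E (gen (ghost e) * gen (vertex (E.s e))) (gen (ghost e))
  | ghost_mul_edge_self (e : W) : Rel E (gen (ghost e) * gen (edge e)) (gen (vertex (E.r e)))
  | ghost_mul_edge_of_ne (e f : W) (h : e ≠ f) : Rel E (gen (ghost e) * gen (edge f)) 0
  | sum_edge_mul_ghost (v : V) (hfin : {e : W | E.s e = v}.Finite)
      (hne : {e : W | E.s e = v}.Nonempty) :
      Rel E (gen (vertex v)) (∑ e ∈ hfin.toFinset, gen (edge e) * gen (ghost e))

/-- The smallest `K`-algebra congruence on the free algebra containing the relations. -/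
inductive Cong (E : DirectedGraph V W) : Free K V W → Free K V W → Prop
  | of {x y : Free K V W} (h : Rel E x y) : Cong E x y
  | refl (x : Free K V W) : Cong E x x
  | symm {x y : Free K V W} (h : Cong E x y) : Cong E y x
  | trans {x y z : Free K V W} (h : Cong E x y) (h' : Cong E y z) : Cong E x z
  | add {x y x' y' : Free K V W} (h : Cong E x y) (h' : Cong E x' y') :
      Cong E (x + x') (y + y')
  | mul {x y x' y' : Free K V W} (h : Cong E x y) (h' : Cong E x' y') :
      Cong E (x * x') (y * y')
  | smul (k : K) {x y : Free K V W} (h : Cong E x y) : Cong E (k • x) (k • y)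

/-- `Cong`, as a congruence of rings. -/
def ringCon (K : Type*) [Field K] (E : DirectedGraph V W) : RingCon (Free K V W) where
  r := Cong E
  iseqv := ⟨Cong.refl, Cong.symm, Cong.trans⟩
  add' := Cong.add
  mul' := Cong.mul

theorem Rel.freeStar [StarRing K] {E : DirectedGraph V W} {x y : Free K V W} (h : Rel E x y) :
    Rel E (freeStar x) (freeStar y) := by
  cases h <;> simp only [freeStar_mul, freeStar_gen, map_zero, map_sum, Gen.adj]
  case vertex_mul_self v => exact .vertex_mul_self v
  case vertex_mul_of_ne v w h => exact .vertex_mul_of_ne w v h.symm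
  case source_mul_edge e => exact .ghost_mul_source e
  case edge_mul_range e => exact .range_mul_ghost e
  case range_mul_ghost e => exact .edge_mul_range e
  case ghost_mul_source e => exact .source_mul_edge e
  case ghost_mul_edge_self e => exact .ghost_mul_edge_self e
  case ghost_mul_edge_of_ne e f h => exact .ghost_mul_edge_of_ne f e h.symm
  case sum_edge_mul_ghost v hfin hne => exact .sum_edge_mul_ghost v hfin hne

theorem Cong.freeStar [StarRing K] {E : DirectedGraph V W} {x y : Free K V W}
    (h : Cong E x y) : Cong E (freeStar x) (freeStar y) := by
  induction h with
  | of h => exact .of h.freeStar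
  | refl x => exact .refl _
  | symm _ ih => exact .symm ih
  | trans _ _ ih ih' => exact .trans ih ih'
  | add _ _ ih ih' => rw [map_add, map_add]; exact .add ih ih'
  | mul _ _ ih ih' => rw [freeStar_mul, freeStar_mul]; exact .mul ih' ih
  | smul k _ ih => rw [freeStar_smul, freeStar_smul]; exact .smul _ ih

end Relations

end Leavitt

/-- The Leavitt path algebra `L_K(E)`: the associative `K`-algebra, in general without unit,
generated by the vertices, edges and ghost edges of `E` subject to the relations `Leavitt.Rel`. -/
def LeavittPathAlgebra (K : Type*) [Field K] {V W : Type*} (E : DirectedGraph V W) :=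
  (Leavitt.ringCon K E).Quotient

namespace LeavittPathAlgebra

open Leavitt

variable {K : Type*} [Field K] {V W : Type*} {E : DirectedGraph V W}

noncomputable instance : NonUnitalRing (LeavittPathAlgebra K E) :=
  inferInstanceAs (NonUnitalRing (Leavitt.ringCon K E).Quotient)

/-- The canonical projection from the free algebra. -/
noncomputable def mk (E : DirectedGraph V W) : Free K V W →ₙ+* LeavittPathAlgebra K E where
  toFun x := (x : (Leavitt.ringCon K E).Quotient)
  map_mul' _ _ := rfl
  map_zero' := rfl
  map_add' _ _ := rfl

theorem mk_surjective : Function.Surjective (mk (K := K) E) := Quotient.mk_surjective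

theorem mk_eq_iff {x y : Free K V W} : mk E x = mk E y ↔ Cong E x y :=
  Quotient.eq (r := (Leavitt.ringCon K E).toSetoid)

noncomputable instance : SMul K (LeavittPathAlgebra K E) where
  smul k := Quotient.map (k • ·) fun _ _ h => Cong.smul k h

theorem mk_smul (k : K) (x : Free K V W) : mk E (k • x) = k • mk E x := rfl

noncomputable instance : Module K (LeavittPathAlgebra K E) :=
  Function.Surjective.module K (mk E).toAddMonoidHom mk_surjective mk_smul

instance : IsScalarTower K (LeavittPathAlgebra K E) (LeavittPathAlgebra K E) where
  smul_assoc k a b := by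
    obtain ⟨x, rfl⟩ := mk_surjective a
    obtain ⟨y, rfl⟩ := mk_surjective b
    simp only [smul_eq_mul, ← mk_smul, ← map_mul, smul_mul_assoc]

instance : SMulCommClass K (LeavittPathAlgebra K E) (LeavittPathAlgebra K E) where
  smul_comm k a b := by
    obtain ⟨x, rfl⟩ := mk_surjective a
    obtain ⟨y, rfl⟩ := mk_surjective b
    simp only [smul_eq_mul, ← mk_smul, ← map_mul, mul_smul_comm]

/-- A vertex, as an element of the Leavitt path algebra. -/
noncomputable def vertex (K : Type*) [Field K] (E : DirectedGraph V W) (v : V) :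
    LeavittPathAlgebra K E := mk E (gen (.vertex v))

/-- An edge `e`, as an element of the Leavitt path algebra. -/
noncomputable def edge (K : Type*) [Field K] (E : DirectedGraph V W) (e : W) :
    LeavittPathAlgebra K E := mk E (gen (.edge e))

/-- A ghost edge `e*`, as an element of the Leavitt path algebra. -/
noncomputable def ghost (K : Type*) [Field K] (E : DirectedGraph V W) (e : W) :
    LeavittPathAlgebra K E := mk E (gen (.ghost e))

section Star

variable [StarRing K]

noncomputable instance : Star (LeavittPathAlgebra K E) where
  star := Quotient.map freeStar fun _ _ h => Cong.freeStar h

theorem star_mk (x : Free K V W) : star (mk E x) = mk E (freeStar x) := rfl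

/-- The involution of `L_K(E)` induced by the involution of `K`: the conjugate-linear
anti-automorphism which fixes the vertices and exchanges `e` and `e*`, so that
`∑ kᵢ pᵢ qᵢ* ↦ ∑ k̄ᵢ qᵢ pᵢ*`. -/
noncomputable instance : StarRing (LeavittPathAlgebra K E) where
  star_involutive a := by
    obtain ⟨x, rfl⟩ := mk_surjective a
    rw [star_mk, star_mk, freeStar_freeStar]
  star_mul a b := by
    obtain ⟨x, rfl⟩ := mk_surjective a
    obtain ⟨y, rfl⟩ := mk_surjective b
    rw [← map_mul, star_mk, star_mk, star_mk, freeStar_mul, map_mul]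
  star_add a b := by
    obtain ⟨x, rfl⟩ := mk_surjective a
    obtain ⟨y, rfl⟩ := mk_surjective b
    rw [← map_add, star_mk, star_mk, star_mk, map_add, map_add]

instance : StarModule K (LeavittPathAlgebra K E) where
  star_smul k a := by
    obtain ⟨x, rfl⟩ := mk_surjective a
    rw [← mk_smul, star_mk, star_mk, freeStar_smul, mk_smul]

theorem star_vertex (v : V) : star (vertex K E v) = vertex K E v := by
  rw [vertex, star_mk, freeStar_gen, Gen.adj]

theorem star_edge (e : W) : star (edge K E e) = ghost K E e := by
  rw [edge, star_mk, freeStar_gen, Gen.adj, ghost]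

theorem star_ghost (e : W) : star (ghost K E e) = edge K E e := by
  rw [ghost, star_mk, freeStar_gen, Gen.adj, edge]

end Star

end LeavittPathAlgebra

/-! The algebra is represented faithfully, with `star` acting as adjoint, on a space carrying an
anisotropic hermitian form. If `star a * a = 0`, then `form (a u) (a u) = form (star a * a u) u = 0`
for every vector `u`. Hence `a u = 0` for all `u`, and faithfulness gives `a = 0`.

The space has as basis the pairs of an infinite path and an integer degree. Paths may also use an
extra loop, `stay`, at each vertex that is not regular, so that every vertex starts an infinite path
and sinks and infinite emitters need no separate treatment. An edge is put in front of a path and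
raises the degree by one; a ghost edge undoes this. No edge acts on or produces the `stay` step, and
regular vertices have no such step, which is exactly what (CK2) needs. The degree is needed for
faithfulness: on a graph with one vertex `v` and one loop `e`, the elements `v` and `e` would
otherwise act alike.

Adjointness is `form_rep_star`; positive definiteness of `K` enters only through
`eq_zero_of_form_self_eq_zero`. Faithfulness is `rep_injective`. By (CK2), every element is a
combination of monomials `p q*` in which `q` has length exactly `N` if its range is regular and at
most `N` otherwise. A monomial in the support with `q` shortest is then isolated by evaluating at
one well-chosen path starting with `q`. -/

namespace Leavitt

/-! ### Infinite paths with waiting steps at the non-regular vertices. -/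

/-- A vertex is regular if it emits a finite nonzero number of edges. -/
def IsRegular {V W : Type*} (E : DirectedGraph V W) (v : V) : Prop :=
  {e : W | E.s e = v}.Finite ∧ {e : W | E.s e = v}.Nonempty

/-- The edges of the graph obtained from `E` by adding a loop at every vertex which is not
regular. -/
inductive Step {V W : Type*} (E : DirectedGraph V W) where
  | stay (v : V) (h : ¬ IsRegular E v) : Step E
  | edge (e : W) : Step E

namespace Step

variable {V W : Type*} {E : DirectedGraph V W}

/-- The source of a step. -/
def s : Step E → V
  | stay v _ => v
  | edge e => E.s e

/-- The range of a step. -/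
def r : Step E → V
  | stay v _ => v
  | edge e => E.r e

theorem exists_step (v : V) :
    ∃ a : Step E, a.s = v ∧ (¬ IsRegular E v → ∀ e, a ≠ edge e) := by
  by_cases h : IsRegular E v
  · obtain ⟨e, he⟩ := h.2
    exact ⟨edge e, he, fun h' => absurd h h'⟩
  · exact ⟨stay v h, rfl, fun _ e => by simp⟩

end Step

/-- Infinite paths consisting of steps. -/
def BoundaryPath {V W : Type*} (E : DirectedGraph V W) :=
  {ξ : ℕ → Step E // ∀ i, (ξ i).r = (ξ (i + 1)).s}

namespace BoundaryPath

variable {V W : Type*} {E : DirectedGraph V W}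

/-- The first step of an infinite path. -/
def head (ξ : BoundaryPath E) : Step E := ξ.1 0

/-- The source of an infinite path. -/
def src (ξ : BoundaryPath E) : V := ξ.head.s

/-- The infinite path with its first step removed. -/
def tail (ξ : BoundaryPath E) : BoundaryPath E := ⟨fun n => ξ.1 (n + 1), fun i => ξ.2 (i + 1)⟩

/-- The infinite path with a further step in front. -/
def cons (a : Step E) (ξ : BoundaryPath E) (h : a.r = ξ.src) : BoundaryPath E :=
  ⟨fun n => Nat.casesOn n a ξ.1, by
    rintro (_ | i)
    · exact h
    · exact ξ.2 i⟩

theorem src_tail (ξ : BoundaryPath E) : ξ.tail.src = ξ.head.r := (ξ.2 0).symm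

theorem ext_head_tail {ξ η : BoundaryPath E} (h : ξ.head = η.head) (h' : ξ.tail = η.tail) :
    ξ = η := by
  apply Subtype.ext
  funext n
  cases n with
  | zero => exact h
  | succ n => exact congrFun (congrArg Subtype.val h') n

/-- Choosing one step at every vertex and iterating gives the path. The condition on the head makes
a path from a non-regular vertex begin by waiting, so that no longer list of edges is an initial
segment of its prolongations. -/
theorem exists_src (v : V) :
    ∃ ξ : BoundaryPath E, ξ.src = v ∧ (¬ IsRegular E v → ∀ e, ξ.head ≠ .edge e) := by
  choose next hs hn using Step.exists_step (E := E)
  refine ⟨⟨fun n => next ((fun u => (next u).r)^[n] v), fun i => ?_⟩, hs v, hn v⟩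
  rw [hs, Function.iterate_succ_apply']

/-- `IsPrepend p ζ η` says that `η` is the concatenation of `p` and `ζ`. -/
def IsPrepend : List W → BoundaryPath E → BoundaryPath E → Prop
  | [], ζ, η => η = ζ
  | e :: p, ζ, η => η.head = .edge e ∧ IsPrepend p ζ η.tail

/-- Two initial segments of one path are comparable. The longer one could only exceed `p` by using
the head of `ξ` as an edge, which `h'` excludes. -/
theorem IsPrepend.eq_and_eq {p q : List W} {ξ ζ η : BoundaryPath E} (hp : IsPrepend p ξ η)
    (hq : IsPrepend q ζ η) (h : p.length ≤ q.length)
    (h' : q.length ≤ p.length ∨ ∀ e, ξ.head ≠ .edge e) : p = q ∧ ξ = ζ := by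
  induction p generalizing q η with
  | nil =>
    cases q with
    | nil => exact ⟨rfl, Eq.trans (Eq.symm hp) hq⟩
    | cons f q =>
      obtain rfl : η = ξ := hp
      rcases h' with h' | h'
      · simp at h'
      · exact absurd hq.1 (h' f)
  | cons e p ih =>
    cases q with
    | nil => simp at h
    | cons f q =>
      have hef : Step.edge (E := E) e = .edge f := hp.1.symm.trans hq.1
      obtain ⟨h₁, h₂⟩ := ih hp.2 hq.2 (by simpa using h) (by simpa using h')
      exact ⟨by rw [Step.edge.inj hef, h₁], h₂⟩

end BoundaryPath

/-- `IsPath E p u v` says that `p` is a path in `E` from `u` to `v`. -/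
def IsPath {V W : Type*} (E : DirectedGraph V W) : List W → V → V → Prop
  | [], u, v => u = v
  | e :: p, u, v => E.s e = u ∧ IsPath E p (E.r e) v

theorem IsPath.exists_isPrepend {V W : Type*} {E : DirectedGraph V W} {p : List W} {u : V}
    {ζ : BoundaryPath E} (h : IsPath E p u ζ.src) :
    ∃ η : BoundaryPath E, η.src = u ∧ BoundaryPath.IsPrepend p ζ η := by
  induction p generalizing u with
  | nil => exact ⟨ζ, h.symm, rfl⟩
  | cons e p ih =>
    obtain ⟨η, h₁, h₂⟩ := ih h.2
    exact ⟨.cons (.edge e) η h₁.symm, h.1, rfl, h₂⟩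

/-! ### The representation of the free algebra on paths with a degree. -/

section Representation

open Classical in
/-- The partial action of the generators on infinite paths with a degree. -/
noncomputable def act {V W : Type*} {E : DirectedGraph V W} :
    Gen V W → BoundaryPath E × ℤ → Option (BoundaryPath E × ℤ)
  | .vertex v, y => if y.1.src = v then some y else none
  | .edge e, y => if h : E.r e = y.1.src then some (.cons (.edge e) y.1 h, y.2 + 1) else none
  | .ghost e, y => if y.1.head = .edge e then some (y.1.tail, y.2 - 1) else none

variable {V W : Type*} {E : DirectedGraph V W}

theorem act_edge_eq_some {e : W} {y z : BoundaryPath E × ℤ} :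
    act (.edge e) y = some z ↔ z.1.head = .edge e ∧ z.1.tail = y.1 ∧ z.2 = y.2 + 1 := by
  simp only [act, Option.dite_none_right_eq_some, Option.some.injEq]
  constructor
  · rintro ⟨h, rfl⟩
    exact ⟨rfl, rfl, rfl⟩
  · rintro ⟨h₁, h₂, h₃⟩
    have h : E.r e = y.1.src := by rw [← h₂, BoundaryPath.src_tail, h₁]; rfl
    exact ⟨h, Prod.ext (BoundaryPath.ext_head_tail h₁.symm h₂.symm) h₃.symm⟩

theorem act_ghost_eq_some {e : W} {y z : BoundaryPath E × ℤ} :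
    act (.ghost e) z = some y ↔ z.1.head = .edge e ∧ z.1.tail = y.1 ∧ z.2 = y.2 + 1 := by
  simp only [act, Option.ite_none_right_eq_some, Option.some.injEq, Prod.ext_iff,
    sub_eq_iff_eq_add]

/-- Generators act by partial injections, and the adjoint generator acts by the inverse one; this is
the source of adjointness for the form. -/
theorem act_adj_eq_some {g : Gen V W} {y z : BoundaryPath E × ℤ} :
    act g.adj z = some y ↔ act g y = some z := by
  cases g with
  | vertex v =>
    simp only [Gen.adj, act, Option.ite_none_right_eq_some, Option.some.injEq]
    constructor <;> (rintro ⟨h, rfl⟩; exact ⟨h, rfl⟩)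
  | edge e => rw [Gen.adj, act_ghost_eq_some, act_edge_eq_some]
  | ghost e => rw [Gen.adj, act_ghost_eq_some, act_edge_eq_some]

variable (K : Type*) [Field K]

/-- The operator by which a generator acts on the vector space with basis the infinite paths
with a degree. -/
noncomputable def op (E : DirectedGraph V W) (g : Gen V W) :
    Module.End K (BoundaryPath E × ℤ →₀ K) :=
  Finsupp.lsum K fun y => (act g y).elim 0 (Finsupp.lsingle (R := K))

variable {K}

theorem op_single (g : Gen V W) (y : BoundaryPath E × ℤ) (l : K) :
    op K E g (.single y l) = (act g y).elim 0 fun z => .single z l := by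
  rw [op, Finsupp.lsum_single]
  cases act g y <;> rfl

open Classical in
theorem op_single_apply (g : Gen V W) (y z : BoundaryPath E × ℤ) (l : K) :
    op K E g (.single y l) z = if act g y = some z then l else 0 := by
  rw [op_single]
  cases h : act g y with
  | none => simp
  | some t => simp [Finsupp.single_apply]

open Classical in
theorem op_vertex_single (v : V) (ξ : BoundaryPath E) (n : ℤ) (l : K) :
    op K E (.vertex v) (.single (ξ, n) l) = if ξ.src = v then .single (ξ, n) l else 0 := by
  rw [op_single, act]
  split_ifs <;> rfl

open Classical in
theorem op_ghost_single (e : W) (ξ : BoundaryPath E) (n : ℤ) (l : K) :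
    op K E (.ghost e) (.single (ξ, n) l) =
      if ξ.head = .edge e then .single (ξ.tail, n - 1) l else 0 := by
  rw [op_single, act]
  split_ifs <;> rfl

/-- Naming the resulting path `η` and writing the argument as its tail avoids the proof term carried
by `cons`. -/
theorem op_edge_single {e : W} {η : BoundaryPath E} (h : η.head = .edge e) (n : ℤ) (l : K) :
    op K E (.edge e) (.single (η.tail, n) l) = .single (η, n + 1) l := by
  have hact : act (.edge e) (η.tail, n) = some (η, n + 1) := act_edge_eq_some.2 ⟨h, rfl, rfl⟩
  rw [op_single, hact]
  rfl

theorem op_edge_single_eq_zero {e : W} {ξ : BoundaryPath E} (h : ξ.src ≠ E.r e) (n : ℤ) (l : K) :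
    op K E (.edge e) (.single (ξ, n) l) = 0 := by
  rw [op_single, act, dif_neg (Ne.symm h)]
  rfl

theorem exists_head_tail {e : W} {ξ : BoundaryPath E} (h : ξ.src = E.r e) :
    ∃ η : BoundaryPath E, η.head = .edge e ∧ η.tail = ξ :=
  ⟨.cons (.edge e) ξ h.symm, rfl, rfl⟩

variable (K) in
/-- The representation of the free algebra extending `op`. -/
noncomputable def freeRep (E : DirectedGraph V W) :
    Free K V W →ₙₐ[K] Module.End K (BoundaryPath E × ℤ →₀ K) :=
  MonoidAlgebra.liftMagma K (FreeSemigroup.lift (op K E))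

theorem freeRep_gen (g : Gen V W) : freeRep K E (gen g) = op K E g := by
  simp [freeRep, gen, MonoidAlgebra.liftMagma]

theorem Rel.freeRep_eq {x y : Free K V W} (h : Rel E x y) : freeRep K E x = freeRep K E y := by
  classical
  cases h <;> simp only [map_mul, map_sum, map_zero, freeRep_gen] <;>
    refine Finsupp.lhom_ext fun y l => ?_ <;> obtain ⟨ξ, n⟩ := y <;>
    simp only [Module.End.mul_apply, LinearMap.zero_apply, LinearMap.sum_apply]
  case vertex_mul_self v =>
    rw [op_vertex_single]
    split_ifs with h
    · rw [op_vertex_single, if_pos h]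
    · rw [map_zero]
  case vertex_mul_of_ne v w h =>
    rw [op_vertex_single]
    split_ifs with h'
    · rw [op_vertex_single, if_neg fun h'' => h (h''.symm.trans h')]
    · rw [map_zero]
  case source_mul_edge e =>
    by_cases h : ξ.src = E.r e
    · obtain ⟨η, h₁, rfl⟩ := exists_head_tail h
      rw [op_edge_single h₁, op_vertex_single, if_pos]
      rw [BoundaryPath.src, h₁]; rfl
    · rw [op_edge_single_eq_zero h, map_zero]
  case edge_mul_range e =>
    rw [op_vertex_single]
    split_ifs with h
    · rfl
    · rw [op_edge_single_eq_zero h, map_zero]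
  case range_mul_ghost e =>
    rw [op_ghost_single]
    split_ifs with h
    · rw [op_vertex_single, if_pos]
      rw [BoundaryPath.src_tail, h]; rfl
    · rw [map_zero]
  case ghost_mul_source e =>
    rw [op_vertex_single]
    split_ifs with h
    · rfl
    · rw [map_zero, op_ghost_single, if_neg]
      exact fun h' => h (by rw [BoundaryPath.src, h']; rfl)
  case ghost_mul_edge_self e =>
    rw [op_vertex_single]
    split_ifs with h
    · obtain ⟨η, h₁, rfl⟩ := exists_head_tail h
      rw [op_edge_single h₁, op_ghost_single, if_pos h₁, add_sub_cancel_right]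
    · rw [op_edge_single_eq_zero h, map_zero]
  case ghost_mul_edge_of_ne e f hne =>
    by_cases h : ξ.src = E.r f
    · obtain ⟨η, h₁, rfl⟩ := exists_head_tail h
      rw [op_edge_single h₁, op_ghost_single, if_neg]
      exact fun h₂ => hne (Step.edge.inj (h₂.symm.trans h₁))
    · rw [op_edge_single_eq_zero h, map_zero]
  case sum_edge_mul_ghost v hfin hne =>
    have key (e : W) : op K E (.edge e) (op K E (.ghost e) (.single (ξ, n) l)) =
        if ξ.head = .edge e then .single (ξ, n) l else 0 := by
      rw [op_ghost_single]
      split_ifs with h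
      · rw [op_edge_single h, sub_add_cancel]
      · rw [map_zero]
    simp only [key]
    rw [op_vertex_single]
    -- If `ξ` starts by waiting, its source is not regular, hence differs from `v`, and both sides
    -- vanish. If it starts with an edge, only that edge can contribute to the sum.
    rcases hξ : ξ.head with ⟨u, hu⟩ | e
    · rw [if_neg, Finset.sum_eq_zero]
      · intro e _
        rw [if_neg (by simp)]
      · rw [BoundaryPath.src, hξ]
        rintro rfl
        exact hu ⟨hfin, hne⟩
    · rw [BoundaryPath.src, hξ]
      simp only [Step.edge.injEq, Finset.sum_ite_eq, Set.Finite.mem_toFinset, Set.mem_ofPred_eq,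
        Step.s]
      congr

theorem Cong.freeRep_eq {x y : Free K V W} (h : Cong E x y) :
    freeRep K E x = freeRep K E y := by
  induction h with
  | of h => exact h.freeRep_eq
  | refl x => rfl
  | symm _ ih => exact ih.symm
  | trans _ _ ih ih' => exact ih.trans ih'
  | add _ _ ih ih' => rw [map_add, map_add, ih, ih']
  | mul _ _ ih ih' => rw [map_mul, map_mul, ih, ih']
  | smul k _ ih => rw [map_smul, map_smul, ih]

end Representation

/-! ### The hermitian form and adjointness of the generators. -/

section Form

variable {K : Type*} [Field K] [StarRing K] {Y : Type*}

/-- The hermitian form for which the standard basis is orthonormal. -/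
noncomputable def form (u w : Y →₀ K) : K := u.sum fun y k => star k * w y

theorem form_single_left (y : Y) (k : K) (w : Y →₀ K) :
    form (.single y k) w = star k * w y := by
  rw [form, Finsupp.sum_single_index (by simp)]

theorem form_add_left (u u' w : Y →₀ K) : form (u + u') w = form u w + form u' w := by
  classical
  exact Finsupp.sum_add_index' (by simp) (by simp [add_mul])

theorem form_zero_left (w : Y →₀ K) : form 0 w = 0 := Finsupp.sum_zero_index

theorem form_add_right (u w w' : Y →₀ K) : form u (w + w') = form u w + form u w' := by
  simp [form, mul_add, Finsupp.sum_add]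

theorem form_zero_right (u : Y →₀ K) : form u 0 = 0 := by
  simp [form, Finsupp.sum]

theorem form_smul_left (k : K) (u w : Y →₀ K) : form (k • u) w = star k * form u w := by
  induction u using Finsupp.induction_linear with
  | zero => simp [form_zero_left]
  | add u u' h h' => rw [smul_add, form_add_left, form_add_left, h, h', mul_add]
  | single y l => rw [Finsupp.smul_single, smul_eq_mul, form_single_left, form_single_left, star_mul', mul_assoc]

theorem form_smul_right (k : K) (u w : Y →₀ K) : form u (k • w) = k * form u w := by
  simp [form, Finsupp.mul_sum, mul_left_comm]

theorem form_single_right (u : Y →₀ K) (y : Y) (l : K) :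
    form u (.single y l) = star (u y) * l := by
  classical
  induction u using Finsupp.induction_linear with
  | zero => simp [form_zero_left]
  | add u u' h h' => rw [form_add_left, h, h', Finsupp.add_apply, star_add, add_mul]
  | single z k =>
    rw [form_single_left, Finsupp.single_apply, Finsupp.single_apply]
    by_cases h : y = z
    · rw [if_pos h, if_pos h.symm]
    · rw [if_neg h, if_neg (Ne.symm h)]; simp

theorem eq_zero_of_form_self_eq_zero (hK : IsPositiveDefiniteInvolution K) {u : Y →₀ K}
    (h : form u u = 0) : u = 0 := by
  by_contra hu
  have hc : 0 < u.support.card := Finset.card_pos.2 (Finsupp.support_nonempty_iff.2 hu)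
  -- The form at `(u, u)` is a sum over the support, so `n`-properness applies with `n` the size of
  -- the support.
  have h' : ∑ i : Fin u.support.card, star (u (u.support.equivFin.symm i)) *
      u (u.support.equivFin.symm i) = 0 := by
    rw [Equiv.sum_comp u.support.equivFin.symm (fun y => star (u y) * u y),
      Finset.sum_coe_sort u.support (fun y => star (u y) * u y)]
    exact h
  have h0 := hK _ hc _ h' ⟨0, hc⟩
  exact Finsupp.mem_support_iff.1 (u.support.equivFin.symm ⟨0, hc⟩).2 h0

variable {V W : Type*} {E : DirectedGraph V W}

/-- In the orthonormal basis the two operators have transposed matrices with entries 0 and 1, which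
`star` fixes. -/
theorem form_op (g : Gen V W) (u w : BoundaryPath E × ℤ →₀ K) :
    form (op K E g.adj u) w = form u (op K E g w) := by
  classical
  induction u using Finsupp.induction_linear with
  | zero => simp [form_zero_left]
  | add u u' h h' => rw [map_add, form_add_left, form_add_left, h, h']
  | single z k =>
    induction w using Finsupp.induction_linear with
    | zero => simp [form_zero_right]
    | add w w' h h' => rw [map_add, form_add_right, form_add_right, h, h']
    | single y l =>
      rw [form_single_left, form_single_right, op_single_apply, op_single_apply]
      simp only [act_adj_eq_some]
      split_ifs <;> simp

end Form

end Leavitt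

/-! ### Descent to the Leavitt path algebra; products of edges. -/

namespace LeavittPathAlgebra

open Leavitt

variable {K : Type*} [Field K] {V W : Type*} {E : DirectedGraph V W}

@[elab_as_elim]
theorem induction_on {P : LeavittPathAlgebra K E → Prop} (a : LeavittPathAlgebra K E)
    (gen : ∀ g, P (mk E (gen g))) (zero : P 0) (gen_mul : ∀ g a, P a → P (mk E (Leavitt.gen g) * a))
    (add : ∀ a b, P a → P b → P (a + b)) (smul : ∀ (k : K) a, P a → P (k • a)) : P a := by
  obtain ⟨x, rfl⟩ := mk_surjective a
  induction x using MonoidAlgebra.induction_linear with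
  | zero => rwa [map_zero]
  | add f g hf hg => rw [map_add]; exact add _ _ hf hg
  | single w k =>
    rw [← mul_one k, ← smul_eq_mul, ← MonoidAlgebra.smul_single, mk_smul]
    apply smul
    induction w using FreeSemigroup.recOnMul with
    | ih1 g => exact gen g
    | ih2 g y _ h =>
      have := gen_mul g _ h
      rwa [← map_mul, Leavitt.gen, MonoidAlgebra.single_mul_single, mul_one] at this

variable (K E) in
/-- The representation of the Leavitt path algebra on the vector space with basis the infinite
paths with a degree. -/
noncomputable def rep :
    LeavittPathAlgebra K E →ₙ+* Module.End K (BoundaryPath E × ℤ →₀ K) where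
  toFun := Quotient.lift (freeRep K E) fun _ _ h => Cong.freeRep_eq h
  map_mul' a b := by
    obtain ⟨x, rfl⟩ := mk_surjective a
    obtain ⟨y, rfl⟩ := mk_surjective b
    exact map_mul (freeRep K E) x y
  map_zero' := map_zero (freeRep K E)
  map_add' a b := by
    obtain ⟨x, rfl⟩ := mk_surjective a
    obtain ⟨y, rfl⟩ := mk_surjective b
    exact map_add (freeRep K E) x y

theorem rep_mk (x : Free K V W) : rep K E (mk E x) = freeRep K E x := rfl

theorem rep_smul (k : K) (a : LeavittPathAlgebra K E) : rep K E (k • a) = k • rep K E a := by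
  obtain ⟨x, rfl⟩ := mk_surjective a
  rw [← mk_smul, rep_mk, rep_mk, map_smul]

theorem rep_gen (g : Gen V W) : rep K E (mk E (gen g)) = op K E g := by
  rw [rep_mk, freeRep_gen]

theorem mk_eq_of_rel {x y : Free K V W} (h : Rel E x y) : mk E x = mk E y :=
  mk_eq_iff.2 (.of h)

theorem vertex_mul_self (v : V) : vertex K E v * vertex K E v = vertex K E v := by
  simpa [vertex, edge, ghost] using mk_eq_of_rel (K := K) (Rel.vertex_mul_self (E := E) v)

theorem vertex_mul_of_ne {v w : V} (h : v ≠ w) : vertex K E v * vertex K E w = 0 := by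
  simpa [vertex, edge, ghost] using mk_eq_of_rel (K := K) (Rel.vertex_mul_of_ne (E := E) v w h)

theorem source_mul_edge (e : W) : vertex K E (E.s e) * edge K E e = edge K E e := by
  simpa [vertex, edge, ghost] using mk_eq_of_rel (K := K) (Rel.source_mul_edge (E := E) e)

theorem edge_mul_range (e : W) : edge K E e * vertex K E (E.r e) = edge K E e := by
  simpa [vertex, edge, ghost] using mk_eq_of_rel (K := K) (Rel.edge_mul_range (E := E) e)

theorem range_mul_ghost (e : W) : vertex K E (E.r e) * ghost K E e = ghost K E e := by
  simpa [vertex, edge, ghost] using mk_eq_of_rel (K := K) (Rel.range_mul_ghost (E := E) e)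

theorem ghost_mul_source (e : W) : ghost K E e * vertex K E (E.s e) = ghost K E e := by
  simpa [vertex, edge, ghost] using mk_eq_of_rel (K := K) (Rel.ghost_mul_source (E := E) e)

theorem ghost_mul_edge_self (e : W) : ghost K E e * edge K E e = vertex K E (E.r e) := by
  simpa [vertex, edge, ghost] using mk_eq_of_rel (K := K) (Rel.ghost_mul_edge_self (E := E) e)

theorem ghost_mul_edge_of_ne {e f : W} (h : e ≠ f) : ghost K E e * edge K E f = 0 := by
  simpa [vertex, edge, ghost] using mk_eq_of_rel (K := K) (Rel.ghost_mul_edge_of_ne (E := E) e f h)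

theorem sum_edge_mul_ghost {v : V} (h : IsRegular E v) :
    vertex K E v = ∑ e ∈ h.1.toFinset, edge K E e * ghost K E e := by
  simpa [vertex, edge, ghost] using mk_eq_of_rel (K := K) (Rel.sum_edge_mul_ghost (E := E) v h.1 h.2)

theorem vertex_mul_edge_of_ne {v : V} {e : W} (h : v ≠ E.s e) :
    vertex K E v * edge K E e = 0 := by
  rw [← source_mul_edge, ← mul_assoc, vertex_mul_of_ne h, zero_mul]

theorem ghost_mul_vertex_of_ne {v : V} {e : W} (h : E.s e ≠ v) :
    ghost K E e * vertex K E v = 0 := by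
  rw [← ghost_mul_source, mul_assoc, vertex_mul_of_ne h, mul_zero]

variable (K E) in
/-- The product of the edges of `p`, followed by the vertex `v`. -/
noncomputable def path : List W → V → LeavittPathAlgebra K E
  | [], v => vertex K E v
  | e :: p, v => edge K E e * path p v

theorem vertex_mul_path {p : List W} {u v : V} (h : IsPath E p u v) :
    vertex K E u * path K E p v = path K E p v := by
  cases p with
  | nil => obtain rfl : u = v := h; exact vertex_mul_self u
  | cons e p =>
    obtain rfl := h.1
    rw [path, ← mul_assoc, source_mul_edge]

/-- Non-composable consecutive edges multiply to zero, so monomials may be indexed by arbitrary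
lists. -/
theorem path_eq_zero_or (p : List W) (v : V) : path K E p v = 0 ∨ ∃ u, IsPath E p u v := by
  induction p with
  | nil => exact .inr ⟨v, rfl⟩
  | cons e p ih =>
    rcases ih with h | ⟨u, h⟩
    · exact .inl (by rw [path, h, mul_zero])
    · by_cases hu : E.r e = u
      · exact .inr ⟨E.s e, rfl, hu ▸ h⟩
      · left
        rw [path, ← edge_mul_range, ← vertex_mul_path h, mul_assoc, ← mul_assoc (vertex K E _),
          vertex_mul_of_ne hu, zero_mul, mul_zero]

theorem path_mul_edge (p : List W) (e : W) :
    path K E p (E.s e) * edge K E e = path K E (p ++ [e]) (E.r e) := by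
  induction p with
  | nil => rw [path, source_mul_edge, List.nil_append, path, path, edge_mul_range]
  | cons f p ih => rw [path, mul_assoc, ih, List.cons_append, path]

theorem path_mul_vertex (p : List W) (v : V) :
    path K E p v * vertex K E v = path K E p v := by
  induction p with
  | nil => exact vertex_mul_self v
  | cons f p ih => rw [path, mul_assoc, ih]

theorem rep_path {p : List W} {ζ η : BoundaryPath E} (h : BoundaryPath.IsPrepend p ζ η) (n : ℤ)
    (l : K) :
    rep K E (path K E p ζ.src) (.single (ζ, n) l) = .single (η, n + p.length) l := by
  induction p generalizing η with
  | nil =>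
    obtain rfl : η = ζ := h
    rw [path, vertex, rep_gen, op_vertex_single, if_pos rfl]
    simp
  | cons e p ih =>
    rw [path, map_mul, Module.End.mul_apply, ih h.2, edge, rep_gen, op_edge_single h.1,
      List.length_cons, Nat.cast_succ, add_assoc]

/-! ### Adjointness on the whole algebra. -/

section Star

variable [StarRing K]

theorem form_rep_star (a : LeavittPathAlgebra K E) (u w : BoundaryPath E × ℤ →₀ K) :
    form (rep K E (star a) u) w = form u (rep K E a w) := by
  induction a using induction_on generalizing u w with
  | gen g => rw [star_mk, freeStar_gen, rep_gen, rep_gen, form_op]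
  | zero => simp [form_zero_left, form_zero_right]
  | gen_mul g a h =>
    rw [star_mul, map_mul, map_mul, Module.End.mul_apply, Module.End.mul_apply, h, star_mk,
      freeStar_gen, rep_gen, rep_gen, form_op]
  | add a b h h' =>
    rw [star_add, map_add, map_add, LinearMap.add_apply, LinearMap.add_apply, form_add_left,
      form_add_right, h, h']
  | smul k a h =>
    rw [star_smul, rep_smul, rep_smul, LinearMap.smul_apply, LinearMap.smul_apply,
      form_smul_left, form_smul_right, star_star, h]

theorem rep_eq_zero_of_star_mul_self (hK : IsPositiveDefiniteInvolution K)
    {a : LeavittPathAlgebra K E} (h : star a * a = 0) : rep K E a = 0 := by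
  refine LinearMap.ext fun u => ?_
  apply eq_zero_of_form_self_eq_zero hK
  rw [← form_rep_star, ← Module.End.mul_apply, ← map_mul, h, map_zero, LinearMap.zero_apply,
    form_zero_left]

theorem rep_star_path {q : List W} {ζ η : BoundaryPath E} (h : BoundaryPath.IsPrepend q ζ η)
    (n : ℤ) (l : K) :
    rep K E (star (path K E q ζ.src)) (.single (η, n) l) = .single (ζ, n - q.length) l := by
  induction q generalizing η n with
  | nil =>
    obtain rfl : η = ζ := h
    rw [path, star_vertex, vertex, rep_gen, op_vertex_single, if_pos rfl]
    simp
  | cons e q ih =>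
    rw [path, star_mul, star_edge, map_mul, Module.End.mul_apply, ghost, rep_gen,
      op_ghost_single, if_pos h.1, ih h.2, List.length_cons, Nat.cast_succ, sub_sub, add_comm]

theorem rep_star_path_eq_zero {q : List W} {v : V} {η : BoundaryPath E}
    (h : ∀ ζ : BoundaryPath E, ζ.src = v → ¬ BoundaryPath.IsPrepend q ζ η) (n : ℤ) (l : K) :
    rep K E (star (path K E q v)) (.single (η, n) l) = 0 := by
  induction q generalizing η n with
  | nil =>
    rw [path, star_vertex, vertex, rep_gen, op_vertex_single, if_neg]
    exact fun h' => h η h' rfl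
  | cons e q ih =>
    rw [path, star_mul, star_edge, map_mul, Module.End.mul_apply, ghost, rep_gen,
      op_ghost_single]
    split_ifs with he
    · exact ih (fun ζ hζ h' => h ζ hζ ⟨he, h'⟩) _
    · rw [map_zero]

/-! ### Spanning by monomials, and their reduction by (CK2). -/

variable (K E) in
/-- The element `p q*`, where `m = (p, v, q)` and `v` is the common range of `p` and `q`. -/
noncomputable def monomial (m : List W × V × List W) : LeavittPathAlgebra K E :=
  path K E m.1 m.2.1 * star (path K E m.2.2 m.2.1)

theorem gen_mul_monomial_mem (g : Gen V W) (m : List W × V × List W) :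
    mk E (gen g) * monomial K E m ∈ Submodule.span K (Set.range (monomial K E)) := by
  have key (m) : monomial K E m ∈ Submodule.span K (Set.range (monomial K E)) :=
    Submodule.subset_span ⟨m, rfl⟩
  obtain ⟨p, v, q⟩ := m
  rw [monomial, ← mul_assoc]
  cases g with
  | vertex w =>
    rw [← vertex]
    cases p with
    | nil =>
      by_cases h : w = v
      · subst h
        rw [path, vertex_mul_self]
        exact key ([], w, q)
      · rw [path, vertex_mul_of_ne h, zero_mul]
        exact zero_mem _
    | cons e p =>
      rw [path, ← mul_assoc (vertex K E w)]
      by_cases h : w = E.s e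
      · subst h
        rw [source_mul_edge]
        exact key (e :: p, v, q)
      · rw [vertex_mul_edge_of_ne h, zero_mul, zero_mul]
        exact zero_mem _
  | edge e => exact key (e :: p, v, q)
  | ghost e =>
    rw [← ghost]
    cases p with
    | nil =>
      by_cases h : E.s e = v
      · subst h
        -- Here `e* q* = (q e)*`; the vertex `r(e)` is split off to serve as the empty left-hand
        -- path.
        rw [path, ghost_mul_source, ← star_edge, ← star_mul, path_mul_edge, ← path_mul_vertex,
          star_mul, star_vertex]
        exact key ([], E.r e, q ++ [e])
      · rw [path, ghost_mul_vertex_of_ne h, zero_mul]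
        exact zero_mem _
    | cons f p =>
      rw [path, ← mul_assoc (ghost K E e)]
      by_cases h : e = f
      · subst h
        rw [ghost_mul_edge_self]
        rcases path_eq_zero_or (K := K) (E := E) p v with h0 | ⟨u, hu⟩
        · rw [h0, mul_zero, zero_mul]
          exact zero_mem _
        · by_cases hr : E.r e = u
          · rw [hr, vertex_mul_path hu]
            exact key (p, v, q)
          · rw [← vertex_mul_path hu, ← mul_assoc, vertex_mul_of_ne hr, zero_mul, zero_mul]
            exact zero_mem _
      · rw [ghost_mul_edge_of_ne h, zero_mul, zero_mul]
        exact zero_mem _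

theorem mem_span_monomial (a : LeavittPathAlgebra K E) :
    a ∈ Submodule.span K (Set.range (monomial K E)) := by
  have hvertex (v : V) : vertex K E v = monomial K E ([], v, []) := by
    rw [monomial, path, star_vertex, vertex_mul_self]
  induction a using induction_on with
  | gen g =>
    cases g with
    | vertex v => exact Submodule.subset_span ⟨_, (hvertex v).symm⟩
    | edge e =>
      rw [← edge, ← edge_mul_range, hvertex]
      exact gen_mul_monomial_mem (.edge e) _
    | ghost e =>
      rw [← ghost, ← ghost_mul_source, hvertex]
      exact gen_mul_monomial_mem (.ghost e) _
  | zero => exact zero_mem _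
  | gen_mul g a h =>
    induction h using Submodule.span_induction with
    | mem _ h =>
      obtain ⟨m, rfl⟩ := h
      exact gen_mul_monomial_mem g m
    | zero => rw [mul_zero]; exact zero_mem _
    | add b c _ _ h h' => rw [mul_add]; exact add_mem h h'
    | smul k b _ h => rw [mul_smul_comm]; exact Submodule.smul_mem _ k h
  | add a b h h' => exact add_mem h h'
  | smul k a h => exact Submodule.smul_mem _ k h

/-- The triples `(p, v, q)` of paths `p` and `q` with common range `v` such that `q` has length
at most `N`, with equality if `v` is regular. -/
def reducedIndex (E : DirectedGraph V W) (N : ℕ) : Set (List W × V × List W) :=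
  {m | (∃ u, IsPath E m.1 u m.2.1) ∧ (∃ u, IsPath E m.2.2 u m.2.1) ∧ m.2.2.length ≤ N ∧
    (IsRegular E m.2.1 → m.2.2.length = N)}

/-- At a regular range, (CK2) inserted in the middle turns `p q*` into the sum of the `(p e)(q e)*`,
which lengthens `q` by one; this is repeated until length `N` or a non-regular range is reached. -/
theorem monomial_mem_span_reduced (N : ℕ) (p : List W) (v : V) (q : List W)
    (h : q.length ≤ N) :
    monomial K E (p, v, q) ∈ Submodule.span K (monomial K E '' reducedIndex E N) := by
  induction hd : N - q.length generalizing p v q with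
  | zero =>
    rcases path_eq_zero_or (K := K) (E := E) p v with hp | hp
    · rw [monomial, hp, zero_mul]; exact zero_mem _
    rcases path_eq_zero_or (K := K) (E := E) q v with hq | hq
    · rw [monomial, hq, star_zero, mul_zero]; exact zero_mem _
    exact Submodule.subset_span
      ⟨_, ⟨hp, hq, h, fun _ => le_antisymm h (Nat.sub_eq_zero_iff_le.1 hd)⟩, rfl⟩
  | succ d ih =>
    by_cases hv : IsRegular E v
    · have : monomial K E (p, v, q) =
          ∑ e ∈ hv.1.toFinset, monomial K E (p ++ [e], E.r e, q ++ [e]) := by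
        rw [monomial, ← path_mul_vertex, sum_edge_mul_ghost hv, Finset.mul_sum, Finset.sum_mul]
        refine Finset.sum_congr rfl fun e he => ?_
        obtain rfl : E.s e = v := by simpa using he
        rw [monomial, ← path_mul_edge, ← path_mul_edge, star_mul, star_edge]
        simp only [mul_assoc]
      rw [this]
      refine Submodule.sum_mem _ fun e _ => ih _ _ _ ?_ ?_ <;>
        rw [List.length_append, List.length_singleton] <;> omega
    · rcases path_eq_zero_or (K := K) (E := E) p v with hp | hp
      · rw [monomial, hp, zero_mul]; exact zero_mem _
      rcases path_eq_zero_or (K := K) (E := E) q v with hq | hq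
      · rw [monomial, hq, star_zero, mul_zero]; exact zero_mem _
      exact Submodule.subset_span ⟨_, ⟨hp, hq, h, fun h' => absurd h' hv⟩, rfl⟩

theorem exists_mem_span_reduced (a : LeavittPathAlgebra K E) :
    ∃ N, a ∈ Submodule.span K (monomial K E '' reducedIndex E N) := by
  obtain ⟨c, rfl⟩ := Finsupp.mem_span_range_iff_exists_finsupp.1 (mem_span_monomial a)
  refine ⟨c.support.sup fun m => m.2.2.length, ?_⟩
  refine Submodule.sum_mem _ fun m hm => Submodule.smul_mem _ _ ?_
  exact monomial_mem_span_reduced _ _ _ _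
    (Finset.le_sup (f := fun m : List W × V × List W => m.2.2.length) hm)

/-! ### Faithfulness of the representation. -/

theorem rep_injective {a : LeavittPathAlgebra K E} (h : rep K E a = 0) : a = 0 := by
  classical
  obtain ⟨N, hN⟩ := exists_mem_span_reduced a
  obtain ⟨c, hc, rfl⟩ := (Finsupp.mem_span_image_iff_linearCombination K).1 hN
  by_contra hne
  have hsupp : c.support.Nonempty := by
    rw [Finsupp.support_nonempty_iff]
    rintro rfl
    exact hne (map_zero _)
  -- With `q` shortest, the test vector is `θ = qξ` and the coefficient read off is the one at `η =
  -- pξ`; only the chosen monomial contributes to it.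
  obtain ⟨⟨p, v, q⟩, hm, hmin⟩ := c.support.exists_min_image (fun m => m.2.2.length) hsupp
  obtain ⟨⟨u, hp⟩, ⟨u', hq⟩, hlen, hreg⟩ := (Finsupp.mem_supported K c).1 hc hm
  obtain ⟨ξ, rfl, hξ⟩ := BoundaryPath.exists_src (E := E) v
  obtain ⟨η, -, hη⟩ := hp.exists_isPrepend
  obtain ⟨θ, -, hθ⟩ := hq.exists_isPrepend
  have hself : rep K E (monomial K E (p, ξ.src, q)) (.single (θ, q.length) 1) =
      .single (η, (p.length : ℤ)) 1 := by
    rw [monomial, map_mul, Module.End.mul_apply, rep_star_path hθ, rep_path hη]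
    simp
  have hother : ∀ m ∈ c.support, m ≠ (p, ξ.src, q) →
      rep K E (monomial K E m) (.single (θ, (q.length : ℤ)) 1) (η, (p.length : ℤ)) = 0 := by
    rintro ⟨p', v', q'⟩ hm' hne'
    obtain ⟨⟨w, hp'⟩, -, hlen', -⟩ := (Finsupp.mem_supported K c).1 hc hm'
    by_cases hex : ∃ ζ : BoundaryPath E, ζ.src = v' ∧ BoundaryPath.IsPrepend q' ζ θ
    · obtain ⟨ζ, rfl, hζ⟩ := hex
      -- By minimality `q'` is no shorter than `q`. It is no longer either: at a regular range `q`
      -- already has the maximal length `N`, and otherwise `ξ` starts by waiting.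
      obtain ⟨rfl, rfl⟩ := hθ.eq_and_eq hζ (hmin _ hm') <| by
        by_cases hr : IsRegular E ξ.src
        · exact .inl (hlen'.trans (hreg hr).ge)
        · exact .inr (hξ hr)
      obtain ⟨η', -, hη'⟩ := hp'.exists_isPrepend
      rw [monomial, map_mul, Module.End.mul_apply, rep_star_path hθ, rep_path hη',
        Finsupp.single_apply, if_neg]
      intro heq
      -- Equal degrees force `p` and `p'` to have equal length, so as initial segments of the same
      -- path they coincide.
      obtain ⟨rfl, hl⟩ := Prod.ext_iff.1 heq
      have hl' : p'.length = p.length := by simpa using hl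
      exact hne' (Prod.ext (hη'.eq_and_eq hη hl'.le (.inl hl'.ge)).1 rfl)
    · rw [monomial, map_mul, Module.End.mul_apply, rep_star_path_eq_zero, map_zero,
        Finsupp.zero_apply]
      exact fun ζ hζ h' => hex ⟨ζ, hζ, h'⟩
  have h0 := DFunLike.congr_fun (LinearMap.congr_fun h (.single (θ, (q.length : ℤ)) 1))
    (η, (p.length : ℤ))
  rw [Finsupp.linearCombination_apply, Finsupp.sum, map_sum, LinearMap.sum_apply,
    Finsupp.finsetSum_apply, Finset.sum_eq_single (p, ξ.src, q)] at h0
  · rw [rep_smul, LinearMap.smul_apply, hself] at h0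
    exact Finsupp.mem_support_iff.1 hm (by simpa using h0)
  · intro m hm' hne'
    rw [rep_smul, LinearMap.smul_apply, Finsupp.smul_apply, hother m hm' hne', smul_zero]
  · exact fun h' => absurd hm h'

end Star

end LeavittPathAlgebra

theorem proposition2p3 {K : Type*} [Field K] [StarRing K]
    (hK : IsPositiveDefiniteInvolution K)
    {V : Type*} {W : Type*} (E : DirectedGraph V W) :
    IsProperInvolution (LeavittPathAlgebra K E) :=
  (isProperInvolution_iff _).2 fun _ h =>
    LeavittPathAlgebra.rep_injective (LeavittPathAlgebra.rep_eq_zero_of_star_mul_self hK h)
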